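/- All graphs are finite and simple. A set $D\subseteq V(G)$ is a total dominating set of a graph $G$ if every vertex of $G$ has at least one neighbour in $D$; the total domination number $\gamma_t(G)$ is the smallest size of a total dominating set of $G$, with $\gamma_t(G)=\infty$ if $G$ has none, that is, if $G$ has an isolated vertex. For an edge $e=uv$ of $G$, the graph $G/e$ is obtained by replacing $u$ and $v$ by one new vertex that is adjacent to precisely those remaining vertices that were adjacent to $u$ or to $v$ in $G$. A graph is $P_5$-free if it has no induced subgraph isomorphic to the path on five vertices. The decision problem $1$-Edge Contraction$(\gamma_t)$ takes as an instance a connected graph $G$ and asks whether $G$ has an edge $e$ with $\gamma_t(G/e)<\gamma_t(G)$ (equivalently, for graphs with at least one edge, $\gamma_t(G/e)\le\gamma_t(G)-1$). Theorem. $1$-Edge Contraction$(\gamma_t)$ is solvable in polynomial time on $P_5$-free graphs: there are a deterministic (multi-stack) Turing machine and a polynomial $p$ such that, for every connected $P_5$-free graph $G$, the machine, given the adjacency matrix of $G$ written as a word $w$, halts within $p(|w|)$ steps and outputs whether $G$ is a yes-instance. Moreover, a connected $P_5$-free graph $G$ with at least two vertices is a yes-instance of $1$-Edge Contraction$(\gamma_t)$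 if and only if $\gamma_t(G)\ge 3$. -/

import Mathlib

namespace GraphContraction

/-- `D` is a total dominating set of `G`: every vertex of `G` has at least one neighbour in `D`. -/
def IsTotalDominatingSet {V : Type*} (G : SimpleGraph V) (D : Set V) : Prop :=
  ∀ v : V, ∃ w ∈ D, G.Adj v w

/-- The total domination number: the smallest size of a total dominating set of `G`.
It is `⊤` when there is no total dominating set (that is, when `G` has an isolated vertex). -/
noncomputable def totalDominationNumber {V : Type*} (G : SimpleGraph V) : ℕ∞ :=
  ⨅ (D : Set V) (_ : IsTotalDominatingSet G D), D.encard

/-- Adjacency in the graph obtained by contracting `uv`: the vertices are the vertices other than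
`u` and `v`, together with one new vertex `none`, which is adjacent to precisely those vertices
that were adjacent to `u` or to `v`. -/
def contractAdj {V : Type*} (G : SimpleGraph V) (u v : V) :
    Option {w : V // w ≠ u ∧ w ≠ v} → Option {w : V // w ≠ u ∧ w ≠ v} → Prop
  | none, none => False
  | none, some b => G.Adj u b ∨ G.Adj v b
  | some a, none => G.Adj u a ∨ G.Adj v a
  | some a, some b => G.Adj a b

/-- The graph `G / uv`, obtained from `G` by contracting the edge `uv`. -/
def contractEdge {V : Type*} (G : SimpleGraph V) (u v : V) :
    SimpleGraph (Option {w : V // w ≠ u ∧ w ≠ v}) where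
  Adj := contractAdj G u v
  symm := ⟨by
    rintro (_ | a) (_ | b) h
    · exact h
    · exact h
    · exact h
    · exact SimpleGraph.Adj.symm (G := G) h⟩
  loopless := ⟨by
    rintro (_ | a) h
    · exact h
    · exact G.irrefl h⟩

/-- `G` is a yes-instance of 1-Edge Contraction(γ_t): the contraction of some edge of `G`
decreases the total domination number. -/
def IsYesInstance {V : Type*} (G : SimpleGraph V) : Prop :=
  ∃ u v : V, G.Adj u v ∧ totalDominationNumber (contractEdge G u v) < totalDominationNumber G

/-- `G` has no induced subgraph isomorphic to the path on five vertices. -/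
def IsP5Free {V : Type*} (G : SimpleGraph V) : Prop :=
  ¬ (SimpleGraph.pathGraph 5).IsIndContained G

/-- Finite simple graphs, as inputs of an algorithm. -/
abbrev FinGraph : Type := Σ n : ℕ, SimpleGraph (Fin n)

open Classical in
/-- The adjacency matrix of a graph, written row by row as a word: the bits `some true` and
`some false` are the entries, and `none` is a separator that ends each row. -/
noncomputable def encodeGraph (x : FinGraph) : List (Option Bool) :=
  (List.finRange x.1).flatMap fun i =>
    (List.finRange x.1).map (fun j => some (decide (x.2.Adj i j))) ++ [none]

theorem encodeGraph_length (x : FinGraph) : (encodeGraph x).length = x.1 * (x.1 + 1) := by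
  simp [encodeGraph, List.length_flatMap]

/-- A graph is determined by its encoding. -/
theorem encodeGraph_injective : Function.Injective encodeGraph := by
  rintro ⟨n, G⟩ ⟨m, H⟩ h
  have hl : n * (n + 1) = m * (m + 1) := by
    simpa only [encodeGraph_length] using congrArg List.length h
  obtain rfl : n = m := by
    rcases lt_trichotomy n m with hlt | heq | hlt
    · nlinarith
    · exact heq
    · nlinarith
  have key : ∀ (l : List (Fin n)) (f g : Fin n → List (Option Bool)),
      (∀ i, (f i).length = (g i).length) → l.flatMap f = l.flatMap g → ∀ i ∈ l, f i = g i := by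
    intro l f g hfg
    induction l with
    | nil => simp
    | cons a l ih =>
      intro h i hi
      simp only [List.flatMap_cons] at h
      obtain ⟨h1, h2⟩ := List.append_inj h (hfg a)
      rcases List.mem_cons.1 hi with rfl | hi
      · exact h1
      · exact ih h2 i hi
  have hG : G = H := by
    ext i j
    have h1 := key _ _ _ (by simp) h i (List.mem_finRange i)
    have h2 := List.append_cancel_right h1
    have h3 := List.map_inj_left.1 h2 j (List.mem_finRange j)
    simpa using h3
  rw [hG]

open Classical in
/-- The decision problem with the given instances and question is solvable in polynomial time:
a Turing machine with finitely many stacks (with finite control, Mathlib's `Turing.FinTM2`), given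
the encoding of any instance, halts with the correct answer as its output, after a number of steps
that is bounded by a polynomial in the length of the encoding. -/
def PolyTimeSolvable (isInstance question : FinGraph → Prop) : Prop :=
  Nonempty (Turing.TM2ComputableInPolyTime
    (fun x : {x : FinGraph // isInstance x} => encodeGraph x.1)
    Computability.encodeBool
    (fun x : {x : FinGraph // isInstance x} => decide (question x.1)))

end GraphContraction

/-!
Why the characterisation holds. Every total dominating set of a nonempty graph has at least two
elements, so a graph with `γ_t = 2` is a no-instance. Conversely, contracting an edge `uv` decreases
`γ_t` as soon as a minimum total dominating set contains a path `u v w`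
(`totalDominationNumber_contractEdge_lt`). Suppose that no minimum total dominating set of a
connected `P₅`-free graph contains such a path, and let `D` be one; then `G[D]` is an induced
matching. A common neighbour of two different edges of the matching either gives an induced `P₅`, or
allows an exchange that does not increase the size and creates a path on three vertices
(`NoPathOfSizeLE.no_common_neighbor`), and so do two adjacent vertices that are neighbours of
different edges of the matching (`NoPathOfSizeLE.no_adjacent_neighbors`). Hence the set of vertices
dominated by one edge of the matching is closed under adjacency; as the graph is connected, this is
the whole vertex set and `γ_t = 2`.

Why the problem is in polynomial time. By the characterisation, a graph with at least two vertices
is a yes-instance if and only if every two rows of its adjacency matrix have a common zero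
(`pairwise_adjRows_iff`). A stack machine checks this by reading each row in turn and comparing it
with all later rows, which takes at most quadratic time in the length of the input
(`runs_read_rows`, `runs_start`). The graph with one vertex, which has `γ_t = ∞` but no edge, is
treated separately.
-/

namespace GraphContraction

/-! ### Total domination and contraction -/

variable {V : Type*} {G : SimpleGraph V} {D : Set V}

theorem totalDominationNumber_le (hD : IsTotalDominatingSet G D) :
    totalDominationNumber G ≤ D.encard :=
  iInf₂_le D hD

theorem IsTotalDominatingSet.two_le_encard [Nonempty V] (hD : IsTotalDominatingSet G D) :
    2 ≤ D.encard := by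
  obtain ⟨v⟩ := ‹Nonempty V›
  obtain ⟨w, hw, -⟩ := hD v
  obtain ⟨w', hw', h⟩ := hD w
  rw [← Set.encard_pair h.ne]
  exact Set.encard_le_encard (Set.pair_subset hw hw')

theorem two_le_totalDominationNumber [Nonempty V] (G : SimpleGraph V) :
    2 ≤ totalDominationNumber G :=
  le_iInf₂ fun _ hD => hD.two_le_encard

theorem exists_encard_eq_totalDominationNumber (h : ∀ v, ∃ w, G.Adj v w) :
    ∃ D, IsTotalDominatingSet G D ∧ D.encard = totalDominationNumber G := by
  have : Nonempty {D : Set V // IsTotalDominatingSet G D} :=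
    ⟨⟨Set.univ, fun v => (h v).imp fun w hw => ⟨Set.mem_univ w, hw⟩⟩⟩
  obtain ⟨D, hD⟩ := ciInf_mem fun D : {D : Set V // IsTotalDominatingSet G D} => D.1.encard
  exact ⟨D.1, D.2, hD.trans (iInf_subtype' (f := fun (D : Set V) _ => D.encard)).symm⟩

/-- Five vertices whose adjacencies are those of a path; that they are distinct follows. -/
theorem IsP5Free.false_of_path (hG : IsP5Free G) {a b c d e : V}
    (hab : G.Adj a b) (hbc : G.Adj b c) (hcd : G.Adj c d) (hde : G.Adj d e)
    (hac : ¬ G.Adj a c) (had : ¬ G.Adj a d) (hae : ¬ G.Adj a e)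
    (hbd : ¬ G.Adj b d) (hbe : ¬ G.Adj b e) (hce : ¬ G.Adj c e) : False := by
  have hadj : ∀ i j : Fin 5, G.Adj (![a, b, c, d, e] i) (![a, b, c, d, e] j) ↔
      (SimpleGraph.pathGraph 5).Adj i j := by
    intro i j
    rw [SimpleGraph.pathGraph_adj]
    fin_cases i <;> fin_cases j <;> simp_all [G.adj_comm]
  refine hG ⟨⟨⟨![a, b, c, d, e], ?_⟩, fun {i j} => hadj i j⟩⟩
  have h1 : a ≠ c := by rintro rfl; exact had hcd
  have h2 : a ≠ d := by rintro rfl; exact hbd hab.symm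
  have h3 : a ≠ e := by rintro rfl; exact hbe hab.symm
  have h4 : b ≠ d := by rintro rfl; exact had hab
  have h5 : b ≠ e := by rintro rfl; exact hae hab
  have h6 : c ≠ e := by rintro rfl; exact hbe hbc
  intro i j h
  fin_cases i <;> fin_cases j <;>
    simp_all [hab.ne, hbc.ne, hcd.ne, hde.ne, hab.ne', hbc.ne', hcd.ne', hde.ne', h1.symm, h2.symm,
      h3.symm, h4.symm, h5.symm, h6.symm]

/-- If a finite total dominating set contains a path `u v w`, then contracting `uv` turns it into a
smaller total dominating set: the new vertex is dominated by `w`. -/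
theorem totalDominationNumber_contractEdge_lt (hD : IsTotalDominatingSet G D) (hfin : D.Finite)
    {u v w : V} (hu : u ∈ D) (hv : v ∈ D) (hw : w ∈ D) (huv : G.Adj u v) (hvw : G.Adj v w)
    (huw : u ≠ w) : totalDominationNumber (contractEdge G u v) < D.encard := by
  classical
  let f : V → Option {x : V // x ≠ u ∧ x ≠ v} :=
    fun x => if h : x ≠ u ∧ x ≠ v then some ⟨x, h⟩ else none
  have hnone : (none : Option {x : V // x ≠ u ∧ x ≠ v}) ∈ f '' (D \ {u}) :=
    ⟨v, ⟨hv, huv.ne'⟩, by simp [f]⟩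
  have hsome : ∀ x (hx : x ≠ u ∧ x ≠ v), x ∈ D → some ⟨x, hx⟩ ∈ f '' (D \ {u}) :=
    fun x hx hxD => ⟨x, ⟨hxD, hx.1⟩, by simp [f, hx]⟩
  have hlt : (D \ {u}).encard < D.encard := by
    rw [← Set.encard_sdiff_singleton_add_one hu]
    exact (ENat.lt_add_one_iff (hfin.subset Set.sdiff_subset).encard_lt_top.ne).2 le_rfl
  refine (totalDominationNumber_le ?_).trans_lt ((Set.encard_image_le f _).trans_lt hlt)
  rintro (_ | a)
  · exact ⟨_, hsome w ⟨huw.symm, hvw.ne'⟩ hw, Or.inr hvw⟩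
  · obtain ⟨d, hd, had⟩ := hD a
    by_cases hdu : d = u
    · exact ⟨none, hnone, Or.inl (hdu ▸ had.symm)⟩
    by_cases hdv : d = v
    · exact ⟨none, hnone, Or.inr (hdv ▸ had.symm)⟩
    · exact ⟨_, hsome d ⟨hdu, hdv⟩ hd, had⟩

/-! ### Minimum total dominating sets of `P₅`-free graphs -/

/-- No total dominating set of size at most `|D|` contains a path on three vertices. -/
def NoPathOfSizeLE (G : SimpleGraph V) (D : Set V) : Prop :=
  ∀ D', IsTotalDominatingSet G D' → D'.encard ≤ D.encard →
    ∀ u ∈ D', ∀ v ∈ D', ∀ w ∈ D', G.Adj u v → G.Adj v w → u = w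

theorem encard_insert_diff_singleton_le {b : V} (hb : b ∈ D) (x : V) :
    (insert x (D \ {b})).encard ≤ D.encard :=
  (Set.encard_insert_le _ _).trans (Set.encard_sdiff_singleton_add_one hb).le

/-- When `D` cannot be replaced by `D - b + x` because the result would contain a path `a x c`,
some vertex is dominated only by `b` in `D`, and is not adjacent to `x`. -/
theorem NoPathOfSizeLE.exists_private (hmin : NoPathOfSizeLE G D) (hD : IsTotalDominatingSet G D)
    {a b c x : V} (ha : a ∈ D) (hb : b ∈ D) (hc : c ∈ D) (hab : a ≠ b) (hcb : c ≠ b) (hac : a ≠ c)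
    (hxa : G.Adj x a) (hxc : G.Adj x c) :
    ∃ y, G.Adj y b ∧ ¬ G.Adj y x ∧ ∀ d ∈ D, d ≠ b → ¬ G.Adj y d := by
  by_contra! hcon
  refine hac (hmin (insert x (D \ {b})) (fun y => ?_) (encard_insert_diff_singleton_le hb x)
    a (.inr ⟨ha, hab⟩) x (.inl rfl) c (.inr ⟨hc, hcb⟩) hxa.symm hxc)
  by_cases hyx : G.Adj y x
  · exact ⟨x, .inl rfl, hyx⟩
  by_cases hyb : G.Adj y b
  · obtain ⟨d, hd, hdb, hyd⟩ := hcon y hyb hyx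
    exact ⟨d, .inr ⟨hd, hdb⟩, hyd⟩
  · obtain ⟨d, hd, hyd⟩ := hD y
    exact ⟨d, .inr ⟨hd, fun h => hyb (h ▸ hyd)⟩, hyd⟩

/-- Two different edges of `G[D]` have no edge between them. -/
theorem NoPathOfSizeLE.not_adj (hmin : NoPathOfSizeLE G D) (hD : IsTotalDominatingSet G D)
    {a₁ b₁ a₂ b₂ : V} (ha₁ : a₁ ∈ D) (hb₁ : b₁ ∈ D) (ha₂ : a₂ ∈ D) (hb₂ : b₂ ∈ D)
    (h₁ : G.Adj a₁ b₁) (h₂ : G.Adj a₂ b₂) (haa : a₁ ≠ a₂) (hab : a₁ ≠ b₂) :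
    ¬ G.Adj a₁ a₂ ∧ ¬ G.Adj a₁ b₂ ∧ ¬ G.Adj b₁ a₂ ∧ ¬ G.Adj b₁ b₂ :=
  ⟨fun h => hab (hmin D hD le_rfl _ ha₁ _ ha₂ _ hb₂ h h₂),
    fun h => haa (hmin D hD le_rfl _ ha₁ _ hb₂ _ ha₂ h h₂.symm),
    fun h => haa (hmin D hD le_rfl _ ha₁ _ hb₁ _ ha₂ h₁ h),
    fun h => hab (hmin D hD le_rfl _ ha₁ _ hb₁ _ hb₂ h₁ h)⟩

/-- In a `P₅`-free graph, two different edges of `G[D]` have no common neighbour. -/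
theorem NoPathOfSizeLE.no_common_neighbor (hmin : NoPathOfSizeLE G D)
    (hD : IsTotalDominatingSet G D) (hG : IsP5Free G) {a₁ b₁ a₂ b₂ x : V}
    (ha₁ : a₁ ∈ D) (hb₁ : b₁ ∈ D) (ha₂ : a₂ ∈ D) (hb₂ : b₂ ∈ D)
    (h₁ : G.Adj a₁ b₁) (h₂ : G.Adj a₂ b₂) (haa : a₁ ≠ a₂) (hab : a₁ ≠ b₂)
    (hx₁ : G.Adj x a₁) (hx₂ : G.Adj x a₂) : False := by
  obtain ⟨naa, nab, nba, nbb⟩ := hmin.not_adj hD ha₁ hb₁ ha₂ hb₂ h₁ h₂ haa hab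
  have hba : b₁ ≠ a₂ := fun h => naa (h ▸ h₁)
  have hbb : b₁ ≠ b₂ := fun h => nab (h ▸ h₁)
  obtain ⟨y₁, hy₁, nyx₁, hp₁⟩ := hmin.exists_private hD ha₁ hb₁ ha₂ h₁.ne hba.symm haa hx₁ hx₂
  obtain ⟨y₂, hy₂, nyx₂, hp₂⟩ := hmin.exists_private hD ha₂ hb₂ ha₁ h₂.ne hab haa.symm hx₂ hx₁
  have n₁a₁ := hp₁ _ ha₁ h₁.ne
  have n₁a₂ := hp₁ _ ha₂ hba.symm
  have n₁b₂ := hp₁ _ hb₂ hbb.symm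
  have n₂a₁ := hp₂ _ ha₁ hab
  have n₂b₁ := hp₂ _ hb₁ hbb
  -- `x` is adjacent to both ends of both edges: otherwise it is the middle vertex of a `P₅`.
  have hxb₂ : G.Adj x b₂ := by
    by_contra hxb₂
    by_cases hxb₁ : G.Adj x b₁
    · exact hG.false_of_path hy₁ hxb₁.symm hx₂ h₂ nyx₁ n₁a₂ n₁b₂ nba nbb hxb₂
    · exact hG.false_of_path h₁.symm hx₁.symm hx₂ h₂ (fun h => hxb₁ h.symm) nba nbb naa nab hxb₂
  have hxb₁ : G.Adj x b₁ := by
    by_contra hxb₁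
    exact hG.false_of_path hy₂ hxb₂.symm hx₁ h₁ nyx₂ n₂a₁ n₂b₁ (fun h => nab h.symm)
      (fun h => nbb h.symm) hxb₁
  have hyy : G.Adj y₁ y₂ := by
    by_contra hyy
    exact hG.false_of_path hy₁ hxb₁.symm hxb₂ hy₂.symm nyx₁ n₁b₂ hyy nbb
      (fun h => n₂b₁ h.symm) (fun h => nyx₂ h.symm)
  -- Exchange `a₁, a₂, b₂` for `x, y₁, y₂`; the new set contains the path `x b₁ y₁`.
  let E : Set V := insert y₂ (insert y₁ (insert x (((D \ {a₁}) \ {a₂}) \ {b₂})))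
  have hE : E.encard ≤ D.encard := by
    have e₁ := Set.encard_sdiff_singleton_add_one ha₁
    have e₂ := Set.encard_sdiff_singleton_add_one (s := D \ {a₁}) (a := a₂) ⟨ha₂, haa.symm⟩
    have e₃ := Set.encard_sdiff_singleton_add_one (s := (D \ {a₁}) \ {a₂}) (a := b₂)
      ⟨⟨hb₂, hab.symm⟩, h₂.ne'⟩
    rw [← e₁, ← e₂, ← e₃]
    refine (Set.encard_insert_le _ _).trans (add_le_add_left ?_ 1)
    refine (Set.encard_insert_le _ _).trans (add_le_add_left ?_ 1)
    exact Set.encard_insert_le _ _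
  have hxE : x ∈ E := .inr (.inr (.inl rfl))
  have hy₁E : y₁ ∈ E := .inr (.inl rfl)
  have hy₂E : y₂ ∈ E := .inl rfl
  have hDE : ∀ d ∈ D, d ≠ a₁ → d ≠ a₂ → d ≠ b₂ → d ∈ E :=
    fun d hd h h' h'' => .inr (.inr (.inr ⟨⟨⟨hd, h⟩, h'⟩, h''⟩))
  have hb₁E : b₁ ∈ E := hDE b₁ hb₁ h₁.ne' hba hbb
  -- A vertex that loses its neighbour `a₁`, `a₂` or `b₂` is the end of a `P₅`, unless `E`
  -- dominates it.
  have hET : IsTotalDominatingSet G E := by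
    intro w
    by_cases hwx : G.Adj w x
    · exact ⟨x, hxE, hwx⟩
    by_cases hwb : G.Adj w b₁
    · exact ⟨b₁, hb₁E, hwb⟩
    by_cases hw₁ : G.Adj w y₁
    · exact ⟨y₁, hy₁E, hw₁⟩
    obtain ⟨d, hd, hwd⟩ := hD w
    by_cases hd₁ : d = a₁
    · subst hd₁
      by_cases hw₂ : G.Adj w y₂
      · exact ⟨y₂, hy₂E, hw₂⟩
      · exact (hG.false_of_path hwd h₁ hy₁.symm hyy hwb hw₁ hw₂
          (fun h => n₁a₁ h.symm) (fun h => n₂a₁ h.symm) (fun h => n₂b₁ h.symm)).elim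
    by_cases hd₂ : d = a₂
    · subst hd₂
      exact (hG.false_of_path hwd hx₂.symm hxb₁ hy₁.symm hwx hwb hw₁
        (fun h => nba h.symm) (fun h => n₁a₂ h.symm) (fun h => nyx₁ h.symm)).elim
    by_cases hd₃ : d = b₂
    · subst hd₃
      exact (hG.false_of_path hwd hxb₂.symm hxb₁ hy₁.symm hwx hwb hw₁
        (fun h => nbb h.symm) (fun h => n₁b₂ h.symm) (fun h => nyx₁ h.symm)).elim
    · exact ⟨d, hDE d hd hd₁ hd₂ hd₃, hwd⟩
  have hxy : x = y₁ := hmin E hET hE x hxE b₁ hb₁E y₁ hy₁E hxb₁ hy₁.symm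
  exact absurd (hxy ▸ hx₁) n₁a₁

/-- In a `P₅`-free graph, neighbours of two different edges of `G[D]` are not adjacent. -/
theorem NoPathOfSizeLE.no_adjacent_neighbors (hmin : NoPathOfSizeLE G D)
    (hD : IsTotalDominatingSet G D) (hG : IsP5Free G) {a₁ b₁ a₂ b₂ x y : V}
    (ha₁ : a₁ ∈ D) (hb₁ : b₁ ∈ D) (ha₂ : a₂ ∈ D) (hb₂ : b₂ ∈ D)
    (h₁ : G.Adj a₁ b₁) (h₂ : G.Adj a₂ b₂) (haa : a₁ ≠ a₂) (hab : a₁ ≠ b₂)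
    (hx : G.Adj x a₁) (hy : G.Adj y a₂) (hxy : G.Adj x y) : False := by
  obtain ⟨naa, nab, nba, nbb⟩ := hmin.not_adj hD ha₁ hb₁ ha₂ hb₂ h₁ h₂ haa hab
  have hba : b₁ ≠ a₂ := fun h => naa (h ▸ h₁)
  have hbb : b₁ ≠ b₂ := fun h => nab (h ▸ h₁)
  have caa : ∀ z, G.Adj z a₁ → ¬ G.Adj z a₂ := fun z h h' =>
    hmin.no_common_neighbor hD hG ha₁ hb₁ ha₂ hb₂ h₁ h₂ haa hab h h'
  have cab : ∀ z, G.Adj z a₁ → ¬ G.Adj z b₂ := fun z h h' =>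
    hmin.no_common_neighbor hD hG ha₁ hb₁ hb₂ ha₂ h₁ h₂.symm hab haa h h'
  have cba : ∀ z, G.Adj z b₁ → ¬ G.Adj z a₂ := fun z h h' =>
    hmin.no_common_neighbor hD hG hb₁ ha₁ ha₂ hb₂ h₁.symm h₂ hba hbb h h'
  have cbb : ∀ z, G.Adj z b₁ → ¬ G.Adj z b₂ := fun z h h' =>
    hmin.no_common_neighbor hD hG hb₁ ha₁ hb₂ ha₂ h₁.symm h₂.symm hbb hba h h'
  have nxa := caa x hx
  have nxb := cab x hx
  have nya : ¬ G.Adj a₁ y := fun h => caa y h.symm hy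
  have nyb : ¬ G.Adj b₁ y := fun h => cba y h.symm hy
  -- The vertices `x` and `y` are each adjacent to both ends of their edge of `G[D]`.
  have hxb : G.Adj x b₁ := by
    by_contra hxb
    exact hG.false_of_path h₁.symm hx.symm hxy hy (fun h => hxb h.symm) nyb nba nya naa nxa
  have hyb : G.Adj y b₂ := by
    by_contra hyb
    exact hG.false_of_path hx.symm hxy hy h₂ nya naa nab nxa nxb hyb
  -- Exchange `b₁, b₂` for `x, y`; the new set contains the path `a₁ x y`.
  let E : Set V := insert y (insert x (D \ {b₁}) \ {b₂})
  have hb₂x : b₂ ∈ insert x (D \ {b₁}) := .inr ⟨hb₂, hbb.symm⟩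
  have hE : E.encard ≤ D.encard := (encard_insert_diff_singleton_le hb₂x y).trans
    (encard_insert_diff_singleton_le hb₁ x)
  have hxE : x ∈ E := .inr ⟨.inl rfl, fun h => nab (h ▸ hx.symm)⟩
  have hDE : ∀ d ∈ D, d ≠ b₁ → d ≠ b₂ → d ∈ E := fun d hd h h' => .inr ⟨.inr ⟨hd, h⟩, h'⟩
  have hET : IsTotalDominatingSet G E := by
    intro w
    by_cases hwx : G.Adj w x
    · exact ⟨x, hxE, hwx⟩
    by_cases hwy : G.Adj w y
    · exact ⟨y, .inl rfl, hwy⟩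
    obtain ⟨d, hd, hwd⟩ := hD w
    by_cases hd₁ : d = b₁
    · subst hd₁
      exact (hG.false_of_path hwd hxb.symm hxy hyb hwx hwy (cbb w hwd) nyb nbb nxb).elim
    by_cases hd₂ : d = b₂
    · subst hd₂
      exact (hG.false_of_path hwd hyb.symm hxy.symm hxb hwy hwx (fun h => cbb w h hwd)
        (fun h => nxb h.symm) (fun h => nbb h.symm) (fun h => nyb h.symm)).elim
    · exact ⟨d, hDE d hd hd₁ hd₂, hwd⟩
  have hay : a₁ = y := hmin E hET hE a₁ (hDE a₁ ha₁ h₁.ne hab) x hxE y (.inl rfl) hx.symm hxy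
  exact naa (hay ▸ hy)

/-- A minimum total dominating set of a connected `P₅`-free graph with no path on three vertices
would have a single edge that dominates the graph, so one with such a path exists if `γ_t ≥ 3`. -/
theorem isYesInstance_of_three_le [Finite V] [Nontrivial V] (hc : G.Connected) (hG : IsP5Free G)
    (h3 : 3 ≤ totalDominationNumber G) : IsYesInstance G := by
  by_contra hno
  obtain ⟨D, hD, hDc⟩ := exists_encard_eq_totalDominationNumber (G := G)
    hc.preconnected.exists_adj_of_nontrivial
  have hmin : NoPathOfSizeLE G D := by
    intro D' hD' hle u hu v hv w hw huv hvw
    by_contra huw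
    exact hno ⟨u, v, huv, (totalDominationNumber_contractEdge_lt hD' (Set.toFinite _) hu hv hw huv
      hvw huw).trans_le (hle.trans hDc.le)⟩
  obtain ⟨v₀⟩ := hc.nonempty
  obtain ⟨a, ha, hva⟩ := hD v₀
  obtain ⟨b, hb, hab⟩ := hD a
  -- The set of vertices dominated by `a` or `b` is closed under adjacency.
  have hclosed : ∀ x y, G.Adj x y → (G.Adj x a ∨ G.Adj x b) → G.Adj y a ∨ G.Adj y b := by
    intro x y hxy hx
    obtain ⟨c, hcD, hyc⟩ := hD y
    obtain ⟨d, hd, hcd⟩ := hD c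
    by_contra! hy
    have hca : a ≠ c := fun h => hy.1 (h ▸ hyc)
    have hcb : b ≠ c := fun h => hy.2 (h ▸ hyc)
    have hda : a ≠ d := fun h => hcb (hmin D hD le_rfl b hb a ha c hcD hab.symm (h ▸ hcd.symm))
    have hdb : b ≠ d := fun h => hca (hmin D hD le_rfl a ha b hb c hcD hab (h ▸ hcd.symm))
    rcases hx with hx | hx
    · exact hmin.no_adjacent_neighbors hD hG ha hb hcD hd hab hcd hca hda hx hyc hxy
    · exact hmin.no_adjacent_neighbors hD hG hb ha hcD hd hab.symm hcd hcb hdb hx hyc hxy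
  have hall : ∀ y, G.Adj y a ∨ G.Adj y b := by
    intro y
    obtain ⟨p⟩ := hc.preconnected v₀ y
    have : ∀ x z, G.Walk x z → (G.Adj x a ∨ G.Adj x b) → G.Adj z a ∨ G.Adj z b := by
      intro x z p
      induction p with
      | nil => exact id
      | cons h _ ih => exact fun hx => ih (hclosed _ _ h hx)
    exact this v₀ y p (.inl hva)
  have hpair : IsTotalDominatingSet G {a, b} := fun y =>
    (hall y).elim (fun h => ⟨a, .inl rfl, h⟩) fun h => ⟨b, .inr rfl, h⟩
  have := h3.trans ((totalDominationNumber_le hpair).trans_eq (Set.encard_pair hab.ne))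
  exact absurd this (by decide)

theorem IsYesInstance.three_le_totalDominationNumber (h : IsYesInstance G) :
    3 ≤ totalDominationNumber G := by
  obtain ⟨u, v, -, h⟩ := h
  have h2 := (two_le_totalDominationNumber (contractEdge G u v)).trans_lt h
  exact Order.add_one_le_of_lt h2

theorem isYesInstance_iff_three_le [Finite V] [Nontrivial V] (hc : G.Connected)
    (hG : IsP5Free G) : IsYesInstance G ↔ 3 ≤ totalDominationNumber G :=
  ⟨IsYesInstance.three_le_totalDominationNumber, isYesInstance_of_three_le hc hG⟩

/-- `γ_t ≥ 3` says that no two vertices dominate the graph, and it is enough to consider pairs of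
different vertices, in increasing order. -/
theorem three_le_totalDominationNumber_iff [LinearOrder V] [Nonempty V] :
    3 ≤ totalDominationNumber G ↔ ∀ u v, u < v → ∃ w, ¬ G.Adj u w ∧ ¬ G.Adj v w := by
  constructor
  · intro h u v huv
    by_contra! hcon
    have hpair : IsTotalDominatingSet G {u, v} := fun w => by
      by_cases hw : G.Adj u w
      · exact ⟨u, .inl rfl, hw.symm⟩
      · exact ⟨v, .inr rfl, (hcon w hw).symm⟩
    have := h.trans ((totalDominationNumber_le hpair).trans_eq (Set.encard_pair huv.ne))
    exact absurd this (by decide)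
  · intro h
    refine le_iInf₂ fun D hD => ?_
    by_contra! hlt
    have h2 : D.encard = 2 := le_antisymm (Order.le_of_lt_add_one hlt) hD.two_le_encard
    obtain ⟨u, v, huv, rfl⟩ := Set.encard_eq_two.1 h2
    obtain ⟨w, hwu, hwv⟩ : ∃ w, ¬ G.Adj u w ∧ ¬ G.Adj v w := by
      rcases huv.lt_or_gt with h' | h'
      · exact h u v h'
      · exact (h v u h').imp fun _ => And.symm
    obtain ⟨d, rfl | rfl, hd⟩ := hD w
    · exact hwu hd.symm
    · exact hwv hd.symm

/-! ### Reachability within a number of steps -/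

open Turing StateTransition

/-- `b` is reached from `a` within `t` steps. -/
def ReachesIn {α : Type*} (f : α → Option α) (t : ℕ) (a b : α) : Prop :=
  Nonempty (EvalsToInTime f a (some b) t)

namespace ReachesIn

variable {α : Type*} {f : α → Option α} {a b c : α} {s t : ℕ}

theorem single (h : f a = some b) : ReachesIn f 1 a b := ⟨⟨⟨1, h⟩, le_rfl⟩⟩

theorem mono (h : ReachesIn f s a b) (hst : s ≤ t) : ReachesIn f t a b :=
  h.elim fun e => ⟨⟨e.toEvalsTo, e.steps_le_m.trans hst⟩⟩

theorem trans (h₁ : ReachesIn f s a b) (h₂ : ReachesIn f t b c) : ReachesIn f (s + t) a c :=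
  h₁.elim fun e₁ => h₂.elim fun e₂ => add_comm t s ▸ ⟨EvalsToInTime.trans f s t a b (some c) e₁ e₂⟩

theorem head (h₁ : f a = some b) (h₂ : ReachesIn f t b c) : ReachesIn f (t + 1) a c :=
  ((single h₁).trans h₂).mono (add_comm 1 t).le

end ReachesIn

/-- The stacks of the machine: `input` holds the rows of the matrix that have not been read,
`scanned` those that the current row has been compared with, `row` and `rowDone` the two parts of
the current row: the entries still to be compared, and, in reverse order, the entries already read
or compared. -/
inductive Stack
  | input | scanned | row | rowDone | output
  deriving DecidableEq

instance : Fintype Stack :=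
  ⟨{.input, .scanned, .row, .rowDone, .output}, fun k => by cases k <;> decide⟩

/-- The alphabets of the stacks. -/
abbrev StackAlphabet : Stack → Type
  | .output => Bool
  | _ => Option Bool

/-- The labels of the machine: `read`, `rewind` and `scan` read a row and compare it with the later
ones, `restore` and `clear` prepare the stacks for the next row, and `drain b` empties the
stacks and outputs `b`. -/
inductive Label
  | start | read | rewind | scan | restore | clear | drain (b : Bool)
  deriving Fintype

/-- The internal states: two buffers for symbols that have just been popped (`none` also when the
stack was empty), and a flag that says whether the two rows that are being compared have together
covered every column so far. -/
abbrev Memory : Type := Option (Option Bool) × Option (Option Bool) × Bool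

/-- The initial internal state. -/
abbrev Memory.init : Memory := (none, none, true)

/-- The bit in a buffer; the buffers that the program applies this to hold one. -/
def bufferBit (x : Option (Option Bool)) : Bool := (x.getD none).getD false

section Program

open Turing.TM2 Turing.TM2.Stmt

/-- Reset the internal state and jump. -/
def jump (l : Label) : Stmt StackAlphabet Label Memory :=
  load (fun _ => .init) (goto fun _ => l)

/-- The program. The current row `u` is read to `rowDone`, rewound to `row`, and compared with every
later row; then the later rows are restored to `input`, and the next row is read. -/
def program : Label → Stmt StackAlphabet Label Memory
  -- A graph with one vertex is recognised by the second symbol, and rejected.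
  | .start =>
    pop .input (fun s x => (x, s.2)) <| peek .input (fun s x => (s.1, x, s.2.2)) <|
      branch (fun s => s.2.1 == some none) (jump (.drain false)) <|
        push .input (fun s => s.1.getD none) <| jump .read
  | .read =>
    pop .input (fun s x => (x, s.2)) <|
      branch (fun s => s.1 == none) (jump (.drain true)) <|
        branch (fun s => s.1 == some none) (jump .rewind) <|
          push .rowDone (fun s => s.1.getD none) <| jump .read
  | .rewind =>
    pop .rowDone (fun s x => (x, s.2)) <|
      branch (fun s => s.1 == none) (jump .scan) <|
        push .row (fun s => s.1.getD none) <| jump .rewind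
  | .scan =>
    pop .input (fun s x => (x, s.2)) <|
      branch (fun s => s.1 == none) (jump .restore) <|
        push .scanned (fun s => s.1.getD none) <|
          branch (fun s => s.1 == some none)
            (branch (fun s => s.2.2) (jump (.drain false)) (jump .rewind)) <|
            pop .row (fun s x => (s.1, x, s.2.2)) <| push .rowDone (fun s => s.2.1.getD none) <|
              load (fun s => (none, none, (bufferBit s.1 || bufferBit s.2.1) && s.2.2)) <|
                goto fun _ => .scan
  | .restore =>
    pop .scanned (fun s x => (x, s.2)) <|
      branch (fun s => s.1 == none) (jump .clear) <|
        push .input (fun s => s.1.getD none) <| jump .restore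
  | .clear =>
    pop .row (fun s x => (x, s.2)) <| branch (fun s => s.1 == none) (jump .read) (jump .clear)
  | .drain b =>
    pop .input (fun s x => (x, s.2)) <| branch (fun s => s.1.isSome) (jump (.drain b)) <|
      pop .scanned (fun s x => (x, s.2)) <| branch (fun s => s.1.isSome) (jump (.drain b)) <|
        pop .row (fun s x => (x, s.2)) <| branch (fun s => s.1.isSome) (jump (.drain b)) <|
          pop .rowDone (fun s x => (x, s.2)) <| branch (fun s => s.1.isSome) (jump (.drain b)) <|
            push .output (fun _ => b) <| load (fun _ => .init) halt

end Program

/-- The machine that decides whether no two vertices of a graph with at least two vertices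
dominate it. -/
def machine : FinTM2 where
  K := Stack
  k₀ := .input
  k₁ := .output
  Γ := StackAlphabet
  Λ := Label
  main := .start
  σ := Memory
  initialState := .init
  Γk₀Fin := inferInstanceAs (Fintype (Option Bool))
  m := program

/-- The contents `a`, `b`, `u`, `p`, `o` of the stacks `input`, `scanned`, `row`, `rowDone`,
`output`. -/
def stackContents (a b u p : List (Option Bool)) (o : List Bool) : ∀ k, List (StackAlphabet k)
  | .input => a
  | .scanned => b
  | .row => u
  | .rowDone => p
  | .output => o

section Update

variable (a b u p a' : List (Option Bool)) (o o' : List Bool)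

@[simp] theorem update_stacks_input :
    Function.update (stackContents a b u p o) .input a' = stackContents a' b u p o := by
  funext k; cases k <;> rfl

@[simp] theorem update_stacks_scanned :
    Function.update (stackContents a b u p o) .scanned a' = stackContents a a' u p o := by
  funext k; cases k <;> rfl

@[simp] theorem update_stacks_row :
    Function.update (stackContents a b u p o) .row a' = stackContents a b a' p o := by
  funext k; cases k <;> rfl

@[simp] theorem update_stacks_rowDone :
    Function.update (stackContents a b u p o) .rowDone a' = stackContents a b u a' o := by
  funext k; cases k <;> rfl

@[simp] theorem update_stacks_output :
    Function.update (stackContents a b u p o) .output o' = stackContents a b u p o' := by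
  funext k; cases k <;> rfl

end Update

/-- A running configuration with empty buffers, flag `f` and an empty output stack. -/
def cfg (l : Label) (f : Bool) (a b u p : List (Option Bool)) :
    TM2.Cfg StackAlphabet Label Memory :=
  ⟨some l, (none, none, f), stackContents a b u p []⟩

/-- The halting configuration with a given output. -/
def haltCfg (ans : Bool) : TM2.Cfg StackAlphabet Label Memory :=
  ⟨none, .init, stackContents [] [] [] [] [ans]⟩

/-! ### Runs of the machine -/

/-- Reachability for the program. -/
abbrev Runs (t : ℕ) (c c' : TM2.Cfg StackAlphabet Label Memory) : Prop :=
  ReachesIn (TM2.step program) t c c'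

variable {a b u p : List (Option Bool)}

theorem runs_rewind : Runs (p.length + 1) (cfg .rewind true a b u p)
    (cfg .scan true a b (p.reverse ++ u) []) := by
  induction p generalizing u with
  | nil => exact .single (by simp [cfg, program, jump, stackContents])
  | cons x p ih =>
    refine .head (b := cfg .rewind true a b (x :: u) p)
      (by simp [cfg, program, jump, stackContents]) ?_
    simpa using ih (u := x :: u)

theorem runs_restore : Runs (b.length + 1) (cfg .restore true a b u p)
    (cfg .clear true (b.reverse ++ a) [] u p) := by
  induction b generalizing a with
  | nil => exact .single (by simp [cfg, program, jump, stackContents])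
  | cons x b ih =>
    refine .head (b := cfg .restore true (x :: a) b u p)
      (by simp [cfg, program, jump, stackContents]) ?_
    simpa using ih (a := x :: a)

theorem runs_clear : Runs (u.length + 1) (cfg .clear true a b u p) (cfg .read true a b [] p) := by
  induction u with
  | nil => exact .single (by simp [cfg, program, jump, stackContents])
  | cons x u ih => exact .head (by simp [cfg, program, jump, stackContents]) ih

theorem runs_read (r : List Bool) : Runs (r.length + 1)
    (cfg .read true (r.map some ++ none :: a) b u p)
    (cfg .rewind true a b u ((r.map some).reverse ++ p)) := by
  induction r generalizing p with
  | nil => exact .single (by simp [cfg, program, jump, stackContents])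
  | cons x r ih =>
    refine .head (b := cfg .read true (r.map some ++ none :: a) b u (some x :: p))
      (by simp [cfg, program, jump, stackContents]) ?_
    simpa using ih (p := some x :: p)

/-- Emptying the stacks takes one step for each symbol, and a last step writes the output. -/
theorem runs_drain (ans : Bool) :
    Runs (a.length + b.length + u.length + p.length + 1) (cfg (.drain ans) true a b u p)
      (haltCfg ans) := by
  induction a with
  | cons x a ih =>
    refine (ReachesIn.head ?_ ih).mono (by simp only [List.length_cons]; omega)
    simp [cfg, program, jump, stackContents]
  | nil =>
  induction b with
  | cons x b ih =>
    refine (ReachesIn.head ?_ ih).mono (by simp only [List.length_cons]; omega)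
    simp [cfg, program, jump, stackContents]
  | nil =>
  induction u with
  | cons x u ih =>
    refine (ReachesIn.head ?_ ih).mono (by simp only [List.length_cons]; omega)
    simp [cfg, program, jump, stackContents]
  | nil =>
  induction p with
  | cons x p ih =>
    refine (ReachesIn.head ?_ ih).mono (by simp)
    simp [cfg, program, jump, stackContents]
  | nil => exact .single (by simp [cfg, haltCfg, program, stackContents])

/-- Two rows of an adjacency matrix together cover every column: the two vertices dominate the
graph. -/
def rowsCover (r s : List Bool) : Bool := (List.zipWith (· || ·) r s).all id

/-- Comparing the current row `r` with the next row `s` of the input. -/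
theorem runs_scan_row (r s : List Bool) (hrs : r.length = s.length) (f : Bool) :
    Runs (s.length + 1)
      (cfg .scan f (s.map some ++ none :: a) b (r.map some) p)
      (cfg (if rowsCover r s && f then .drain false else .rewind) true a
        (none :: (s.map some).reverse ++ b) [] ((r.map some).reverse ++ p)) := by
  induction s generalizing r b p f with
  | nil =>
    obtain rfl := List.eq_nil_of_length_eq_zero hrs
    refine .single ?_
    cases f <;> simp [cfg, program, jump, stackContents, rowsCover]
  | cons y s ih =>
    obtain _ | ⟨x, r⟩ := r
    · simp at hrs
    refine .head (b := cfg .scan ((y || x) && f) (s.map some ++ none :: a) (some y :: b)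
      (r.map some) (some x :: p)) (by simp [cfg, program, stackContents, bufferBit]) ?_
    have hc : (rowsCover (x :: r) (y :: s) && f) = (rowsCover r s && ((y || x) && f)) := by
      simp only [rowsCover, List.zipWith_cons_cons, List.all_cons, id]
      cases x <;> cases y <;> cases f <;> simp
    rw [hc]
    simpa using ih (b := some y :: b) (p := some x :: p) r (by simpa using hrs) ((y || x) && f)

/-- The word that encodes a list of rows. -/
def encodeRows (rows : List (List Bool)) : List (Option Bool) :=
  rows.flatMap fun r => r.map some ++ [none]

theorem encodeRows_cons (r : List Bool) (rows : List (List Bool)) :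
    encodeRows (r :: rows) = r.map some ++ none :: encodeRows rows := by
  simp [encodeRows]

theorem encodeRows_length {n : ℕ} {rows : List (List Bool)} (h : ∀ r ∈ rows, r.length = n) :
    (encodeRows rows).length = rows.length * (n + 1) := by
  induction rows with
  | nil => simp [encodeRows]
  | cons r rows ih =>
    rw [encodeRows_cons, List.length_append, List.length_cons, List.length_map,
      ih fun s hs => h s (.tail _ hs), h r (.head _), List.length_cons]
    ring

/-- Comparing the current row with all later rows, when it covers every column with none of them. -/
theorem runs_scan_of_forall {n : ℕ} {r : List Bool} (hr : r.length = n) {rows : List (List Bool)}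
    (h : ∀ s ∈ rows, s.length = n) (hc : ∀ s ∈ rows, rowsCover r s = false) :
    Runs (rows.length * (2 * n + 2) + 1) (cfg .scan true (encodeRows rows) b (r.map some) [])
      (cfg .restore true [] ((encodeRows rows).reverse ++ b) (r.map some) []) := by
  induction rows generalizing b with
  | nil => exact .mono (.single (by simp [cfg, program, jump, stackContents, encodeRows])) (by simp)
  | cons s rows ih =>
    have hs := h s (.head _)
    have h₁ := runs_scan_row (a := encodeRows rows) (b := b) (p := []) r s (hr.trans hs.symm) true
    rw [hc s (.head _)] at h₁
    have h₂ := ih (b := none :: (s.map some).reverse ++ b) (fun t ht => h t (.tail _ ht))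
      fun t ht => hc t (.tail _ ht)
    rw [encodeRows_cons]
    have h₃ : Runs (2 * n + 2)
        (cfg .scan true (s.map some ++ none :: encodeRows rows) b (r.map some) [])
        (cfg .scan true (encodeRows rows) (none :: (s.map some).reverse ++ b) (r.map some) []) := by
      simpa using (h₁.trans runs_rewind).mono (t := 2 * n + 2) (by simp [hs, hr]; omega)
    rw [show (s.map some ++ none :: encodeRows rows).reverse ++ b =
      (encodeRows rows).reverse ++ (none :: (s.map some).reverse ++ b) by simp]
    refine (h₃.trans h₂).mono ?_
    rw [List.length_cons]
    linarith

/-- Comparing the current row with the later rows, when it covers every column with one of them: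
the machine stops at the first such row and rejects. -/
theorem runs_scan_of_exists {n : ℕ} {r : List Bool} (hr : r.length = n) {rows : List (List Bool)}
    (h : ∀ s ∈ rows, s.length = n) (hc : ∃ s ∈ rows, rowsCover r s = true) :
    Runs (rows.length * (3 * n + 3) + b.length + n + 1)
      (cfg .scan true (encodeRows rows) b (r.map some) []) (haltCfg false) := by
  induction rows generalizing b with
  | nil => simp at hc
  | cons s rows ih =>
    have hs := h s (.head _)
    have h₁ := runs_scan_row (a := encodeRows rows) (b := b) (p := []) r s (hr.trans hs.symm) true
    have hl := encodeRows_length fun t ht => h t (.tail _ ht)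
    rw [encodeRows_cons]
    cases hcs : rowsCover r s
    · rw [hcs] at h₁
      have h₂ := ih (b := none :: (s.map some).reverse ++ b) (fun t ht => h t (.tail _ ht)) (by
        obtain ⟨t, ht, htc⟩ := hc
        rcases List.mem_cons.1 ht with rfl | ht
        · simp [hcs] at htc
        · exact ⟨t, ht, htc⟩)
      have h₃ : Runs (2 * n + 2)
          (cfg .scan true (s.map some ++ none :: encodeRows rows) b (r.map some) [])
          (cfg .scan true (encodeRows rows) (none :: (s.map some).reverse ++ b)
            (r.map some) []) := by
        simpa using (h₁.trans runs_rewind).mono (t := 2 * n + 2) (by simp [hs, hr]; omega)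
      refine (h₃.trans h₂).mono ?_
      simp [hs]
      linarith
    · rw [hcs] at h₁
      refine (h₁.trans (runs_drain _)).mono ?_
      simp [hs, hr, hl]
      nlinarith

/-- The main loop decides whether no two rows cover every column. Each row `r` of length `n` costs a
bounded number of passes over the remaining input, whose length is at most `K`. -/
theorem runs_read_rows {n K : ℕ} {rows : List (List Bool)} (h : ∀ s ∈ rows, s.length = n)
    (hK : rows.length * (n + 1) ≤ K) {ans : Bool}
    (hans : ans = true ↔ rows.Pairwise fun r s => rowsCover r s = false) :
    Runs (rows.length * (7 * K + 2) + 2) (cfg .read true (encodeRows rows) [] [] [])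
      (haltCfg ans) := by
  induction rows with
  | nil =>
    obtain rfl : ans = true := hans.2 .nil
    exact .mono (.head (b := cfg (.drain true) true [] [] [] [])
      (by simp [cfg, program, jump, stackContents, encodeRows]) (runs_drain true)) (by simp)
  | cons r rows ih =>
    have hr := h r (.head _)
    have hrows : ∀ s ∈ rows, s.length = n := fun s hs => h s (.tail _ hs)
    have hl := encodeRows_length hrows
    simp only [List.length_cons, add_mul, one_mul] at hK
    have h₁ : Runs (2 * n + 2) (cfg .read true (encodeRows (r :: rows)) [] [] [])
        (cfg .scan true (encodeRows rows) [] (r.map some) []) := by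
      rw [encodeRows_cons]
      simpa using ((runs_read (a := encodeRows rows) (b := []) (u := []) (p := []) r).trans
        runs_rewind).mono (t := 2 * n + 2) (by simp [hr]; omega)
    rw [List.pairwise_cons] at hans
    by_cases hc : ∀ s ∈ rows, rowsCover r s = false
    · have h₂ := runs_scan_of_forall (b := []) hr hrows hc
      have h₃ := ih hrows (by omega) (hans.trans (and_iff_right hc))
      have h₄ := ((h₁.trans h₂).trans runs_restore).trans runs_clear
      simp only [List.append_nil, List.reverse_reverse] at h₄
      refine (h₄.trans h₃).mono ?_
      simp [hr, hl]
      nlinarith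
    · obtain rfl : ans = false := by
        cases ans
        · rfl
        · exact (hc (hans.1 rfl).1).elim
      push Not at hc
      refine (h₁.trans (runs_scan_of_exists (b := []) hr hrows (by simpa using hc))).mono ?_
      simp
      nlinarith

/-! ### The machine on graphs -/

/-- The rows of the adjacency matrix. -/
noncomputable def adjRows {n : ℕ} (G : SimpleGraph (Fin n)) : List (List Bool) :=
  open Classical in List.ofFn fun i => List.ofFn fun j => decide (G.Adj i j)

theorem encodeGraph_eq {n : ℕ} (G : SimpleGraph (Fin n)) :
    encodeGraph ⟨n, G⟩ = encodeRows (adjRows G) := by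
  simp only [encodeGraph, encodeRows, adjRows, List.ofFn_eq_map, List.flatMap_map, List.map_map]
  rfl

theorem rowsCover_ofFn {n : ℕ} (f g : Fin n → Bool) :
    rowsCover (List.ofFn f) (List.ofFn g) = true ↔ ∀ j, f j = true ∨ g j = true := by
  simp [rowsCover, List.ofFn_eq_map, List.zipWith_map, List.zipWith_self]

theorem pairwise_adjRows_iff {n : ℕ} [NeZero n] (G : SimpleGraph (Fin n)) :
    (adjRows G).Pairwise (fun r s => rowsCover r s = false) ↔ 3 ≤ totalDominationNumber G := by
  rw [adjRows, List.pairwise_ofFn, three_le_totalDominationNumber_iff]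
  refine forall₂_congr fun u v => imp_congr_right fun _ => ?_
  rw [← Bool.not_eq_true, rowsCover_ofFn]
  simp

/-- The number of steps is a polynomial in the length `n * (n + 1)` of the input. -/
theorem runs_start {n : ℕ} (G : SimpleGraph (Fin n)) (hG : G.Connected) (hP : IsP5Free G)
    {ans : Bool} (hans : ans = true ↔ IsYesInstance G) :
    Runs (7 * (n * (n + 1)) ^ 2 + 2 * (n * (n + 1)) + 3)
      (cfg .start true (encodeGraph ⟨n, G⟩) [] [] []) (haltCfg ans) := by
  obtain _ | _ | n := n
  · exact hG.nonempty.elim fun v => v.elim0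
  · obtain rfl : ans = false := by
      rw [← Bool.not_eq_true, hans]
      rintro ⟨u, v, h, -⟩
      exact h.ne (Subsingleton.elim (α := Fin 1) u v)
    refine .mono (.head (b := cfg (.drain false) true [none] [] [] []) ?_ (runs_drain false))
      (by simp)
    simp [cfg, program, jump, stackContents, encodeGraph_eq, encodeRows, adjRows, List.ofFn_succ]
  · rw [isYesInstance_iff_three_le hG hP, ← pairwise_adjRows_iff] at hans
    have hlen : (adjRows G).length = n + 2 := by simp [adjRows]
    have h := runs_read_rows (n := n + 2) (K := (n + 2) * (n + 2 + 1)) (by simp [adjRows])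
      (by rw [hlen]) hans
    rw [encodeGraph_eq]
    refine .mono (.head (b := cfg .read true (encodeRows (adjRows G)) [] [] []) ?_ h) ?_
    · simp [cfg, program, jump, stackContents, encodeRows, adjRows, List.ofFn_succ]
    · rw [hlen]
      nlinarith

theorem initList_machine (w : List (Option Bool)) :
    (initList machine w : TM2.Cfg StackAlphabet Label Memory) = cfg .start true w [] [] [] := by
  refine congrArg (TM2.Cfg.mk _ _) (funext fun k => ?_)
  cases k <;> rfl

theorem haltList_machine (ans : Bool) :
    (haltList machine [ans] : TM2.Cfg StackAlphabet Label Memory) = haltCfg ans := by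
  refine congrArg (TM2.Cfg.mk _ _) (funext fun k => ?_)
  cases k <;> rfl

theorem polyTimeSolvable_isYesInstance :
    PolyTimeSolvable (fun x => x.2.Connected ∧ IsP5Free x.2) fun x => IsYesInstance x.2 := by
  refine ⟨{
    tm := machine
    inputAlphabet := Equiv.refl (Option Bool)
    outputAlphabet := Equiv.refl Bool
    time := 7 * Polynomial.X ^ 2 + 2 * Polynomial.X + 3
    outputsFun := fun x => Classical.choice ?_ }⟩
  obtain ⟨⟨n, G⟩, hG, hP⟩ := x
  classical
  have h := runs_start G hG hP (decide_eq_true_iff (p := IsYesInstance G))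
  rw [← List.map_id (encodeGraph ⟨n, G⟩), ← initList_machine, ← haltList_machine] at h
  have ht : (7 * Polynomial.X ^ 2 + 2 * Polynomial.X + 3 : Polynomial ℕ).eval
      (encodeGraph ⟨n, G⟩).length = 7 * (n * (n + 1)) ^ 2 + 2 * (n * (n + 1)) + 3 := by
    simp [encodeGraph_length]
  rw [ht]
  exact h

end GraphContraction

theorem mainTheorem7 :
    GraphContraction.PolyTimeSolvable
      (fun x => x.2.Connected ∧ GraphContraction.IsP5Free x.2)
      (fun x => GraphContraction.IsYesInstance x.2) ∧
    ∀ {V : Type*} [Finite V] [Nontrivial V] (G : SimpleGraph V),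
      G.Connected → GraphContraction.IsP5Free G →
        (GraphContraction.IsYesInstance G ↔ 3 ≤ GraphContraction.totalDominationNumber G) :=
  ⟨GraphContraction.polyTimeSolvable_isYesInstance,
    fun _ hc hG => GraphContraction.isYesInstance_iff_three_le hc hG⟩
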